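/- Three players $i\in\{1,2,3\}$ share finitely many divisible items $j\in M$; player $i$ values item $j$ at $a_{ij}$, with $\sum_{j} a_{ij}=1$ for every $i$, and mutual absolute continuity (MAC) holds: $a_{ij}>0$ for all $i,j$. An allocation is a matrix $X=(x_{ij})$ with $x_{ij}\ge 0$ and $\sum_i x_{ij}=1$ for every $j$; its value vector is $a(X)=\bigl(\sum_j a_{ij}x_{ij}\bigr)_i$, and $IPS=\{a(X)\}\subset\mathbb{R}^3$ is the set of all value vectors. The allocation $X$ is Pareto optimal if no allocation $Y$ satisfies $a_i(Y)\ge a_i(X)$ for all $i$ with strict inequality for some $i$. A Pareto face is a two-dimensional face of the polytope $IPS$ all of whose points are value vectors of Pareto optimal allocations. Let $\Delta=\{\beta\in\mathbb{R}^3:\beta_i\ge 0,\ \sum_i\beta_i=1\}$, with corners $e_1,e_2,e_3$ and relative interior $\mathring\Delta$, and represent item $j$ by the point $a^n_j=(a_{1j},a_{2j},a_{3j})/\sum_i a_{ij}\in\mathring\Delta$. The supporting segments of item $j$ are the closed segments from $a^n_j$ to $e_1$, $e_2$, $e_3$. Two items are s-independent if the point of neither lies on a supporting segment of the other. Let $V$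 be the set of the points of $\mathring\Delta$ that coincide with some $a^n_j$ or lie on supporting segments of two s-independent items. Let $\mathcal G$ be the graph on $V$ in which two distinct vertices are joined by an arc if and only if some supporting segment contains both and no vertex in $V$ lies strictly between them. For $\beta\in\mathring\Delta$ let $\gamma(\beta)$ be the vector proportional to $(1/\beta_1,1/\beta_2,1/\beta_3)$ with coordinates of sum $1$, and let $F(\beta)$ be the set of points of $IPS$ at which $x\mapsto\sum_i\gamma_i(\beta)x_i$ attains its maximum over $IPS$. **Theorem.** The map $\beta\mapsto F(\beta)$ is a bijection from $V$ onto the set of Pareto faces. For any two distinct vertices $v,w\in V$, the corresponding faces $F(v)$ and $F(w)$ are adjacent if and only if $v$ and $w$ are joined by an arc of $\mathcal G$. Here adjacent can be read in either of two ways: the faces have a nondegenerate line segment in common, or they have a common edge (a one-dimensional face of both). -/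

import Mathlib

namespace FairDivision

/-- An allocation of the (divisible) items in `M` among three players: `X i j` is the share of
item `j` that player `i` receives. -/
def IsAllocation {M : Type*} (X : Fin 3 → M → ℝ) : Prop :=
  (∀ i j, 0 ≤ X i j) ∧ ∀ j, ∑ i, X i j = 1

/-- The vector of the total values that the players derive from `X`. -/
def value {M : Type*} [Fintype M] (a X : Fin 3 → M → ℝ) : Fin 3 → ℝ :=
  fun i => ∑ j, a i j * X i j

/-- The Individual Pieces Set (partition range). -/
def IPS {M : Type*} [Fintype M] (a : Fin 3 → M → ℝ) : Set (Fin 3 → ℝ) :=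
  {x | ∃ X, IsAllocation X ∧ value a X = x}

/-- (Strong) Pareto optimality of an allocation. -/
def IsParetoOptimal {M : Type*} [Fintype M] (a X : Fin 3 → M → ℝ) : Prop :=
  IsAllocation X ∧
    ¬ ∃ Y, IsAllocation Y ∧ (∀ i, value a X i ≤ value a Y i) ∧ ∃ i, value a X i < value a Y i

/-- The Pareto boundary (upper border) of the IPS. -/
def paretoBoundary {M : Type*} [Fintype M] (a : Fin 3 → M → ℝ) : Set (Fin 3 → ℝ) :=
  {x | ∃ X, IsParetoOptimal a X ∧ value a X = x}

/-- A face on the upper border: a two-dimensional face of the polytope IPS that lies in the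
Pareto boundary. -/
def IsParetoFace {M : Type*} [Fintype M] (a : Fin 3 → M → ℝ) (F : Set (Fin 3 → ℝ)) : Prop :=
  IsExposed ℝ (IPS a) F ∧ Module.finrank ℝ (vectorSpan ℝ F) = 2 ∧ F ⊆ paretoBoundary a

/-- `E` is an edge (one-dimensional face) of the convex polytope `F`. -/
def IsEdgeOf (F E : Set (Fin 3 → ℝ)) : Prop :=
  IsExposed ℝ F E ∧ Module.finrank ℝ (vectorSpan ℝ E) = 1

/-- The two sets have a common edge. -/
def ShareEdge (F G : Set (Fin 3 → ℝ)) : Prop :=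
  ∃ E, IsEdgeOf F E ∧ IsEdgeOf G E

/-- The two sets have a common nondegenerate line segment. -/
def ShareSegment (F G : Set (Fin 3 → ℝ)) : Prop :=
  ∃ p q, p ≠ q ∧ segment ℝ p q ⊆ F ∩ G

/-- The normalizing operator `N`. -/
noncomputable def normalize (x : Fin 3 → ℝ) : Fin 3 → ℝ :=
  fun i => x i / ∑ k, x k

/-- The relative interior of the Radon–Nikodym set, which is the two-dimensional standard
simplex. -/
def interiorRNS : Set (Fin 3 → ℝ) :=
  {β | (∀ i, 0 < β i) ∧ ∑ i, β i = 1}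

/-- The vertex of the Radon–Nikodym set that represents player `i`. -/
def corner (i : Fin 3) : Fin 3 → ℝ := Pi.single i 1

/-- The point of the Radon–Nikodym set that represents item `j`. -/
noncomputable def item {M : Type*} (a : Fin 3 → M → ℝ) (j : M) : Fin 3 → ℝ :=
  normalize (fun i => a i j)

/-- The supporting segment of item `j` towards the vertex of player `i`. -/
def supportingSegment {M : Type*} (a : Fin 3 → M → ℝ) (j : M) (i : Fin 3) :
    Set (Fin 3 → ℝ) :=
  segment ℝ (item a j) (corner i)

/-- Support independence of two items: neither of the two points lies on a supporting segment of
the other item. -/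
def SIndependent {M : Type*} (a : Fin 3 → M → ℝ) (j k : M) : Prop :=
  (∀ i, item a j ∉ supportingSegment a k i) ∧ ∀ i, item a k ∉ supportingSegment a j i

/-- The vertices of the graph: the interior points of the Radon–Nikodym set that coincide with an
item or at which supporting segments of two s-independent items intersect. (Supporting segments
of items that are not s-independent meet, inside the simplex, only in items or in a whole
overlap of two segments that end in the same corner.) -/
def graphVertices {M : Type*} (a : Fin 3 → M → ℝ) : Set (Fin 3 → ℝ) :=
  {β | β ∈ interiorRNS ∧
    ((∃ j, β = item a j) ∨
      ∃ j k, SIndependent a j k ∧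
        ∃ i i', β ∈ supportingSegment a j i ∧ β ∈ supportingSegment a k i')}

/-- The graph: an arc joins two distinct vertices that lie on a common supporting segment with no
other vertex strictly in between. -/
def graph {M : Type*} (a : Fin 3 → M → ℝ) : SimpleGraph (graphVertices a) where
  Adj v w := v ≠ w ∧
    (∃ j i, v.1 ∈ supportingSegment a j i ∧ w.1 ∈ supportingSegment a j i) ∧
    ∀ u ∈ graphVertices a, u ∉ openSegment ℝ v.1 w.1
  symm := ⟨by
    rintro v w ⟨hne, ⟨j, i, hv, hw⟩, hu⟩
    refine ⟨hne.symm, ⟨j, i, hw, hv⟩, fun u h => ?_⟩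
    rw [openSegment_symm]
    exact hu u h⟩
  loopless := ⟨fun _ h => h.1 rfl⟩

/-- The map `RD` between points of the interior of the Radon–Nikodym set and coefficient vectors
of supporting hyperplanes. -/
noncomputable def RD (x : Fin 3 → ℝ) : Fin 3 → ℝ :=
  normalize (fun i => (x i)⁻¹)

/-- The set of points at which the hyperplane with coefficient vector `γ` supports the IPS from
above. -/
def supportSet {M : Type*} [Fintype M] (a : Fin 3 → M → ℝ) (γ : Fin 3 → ℝ) :
    Set (Fin 3 → ℝ) :=
  {x | x ∈ IPS a ∧ ∀ y ∈ IPS a, ∑ i, γ i * y i ≤ ∑ i, γ i * x i}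

/-- The part of the upper border that corresponds to the point `β`. -/
noncomputable def faceOf {M : Type*} [Fintype M] (a : Fin 3 → M → ℝ) (β : Fin 3 → ℝ) :
    Set (Fin 3 → ℝ) :=
  supportSet a (RD β)

end FairDivision

/-! ### Planes, normal vectors and the passage between points and weights -/

namespace FairDivision

/-! A weighted sum of values splits by items, so an allocation maximizes it for weights γ exactly
when every item goes only to players with the largest γ_i a_ij (`value_mem_supportSet`). For γ = `RD
β` these are the players with the largest a_ij / β_i, and β lies on the supporting segment of j
towards e_m exactly when both players other than m are best for j (`mem_supportingSegment`). The
segments thus record which players tie for which items.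

Tied players can trade the item, which yields a direction of the face. Hence F(β) is two-dimensional
exactly when ties connect all three players, that is, when β lies on segments towards two different
corners (`mem_graphVertices_iff_vectorSpan`); these points are the vertices (`mem_graphVertices`).
Conversely, Pareto optimality forces a strictly positive normal on every Pareto face
(`IsParetoFace.exists_pos_normal`), so every such face comes from some β.

Two faces share a segment exactly when every item has a player that is best at both points and some
item has two such players, so that both points lie on one of its segments (`shareSegment_iff`).
Along that segment an item can lose all common best players only by crossing a tie, and such a tie
is a vertex strictly in between (`exists_common_best_iff`). -/

theorem exists_third (i k : Fin 3) : ∃ m, m ≠ i ∧ m ≠ k := by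
  revert i k; decide

theorem eq_or_eq_or_eq {i k m : Fin 3} (hik : i ≠ k) (him : i ≠ m) (hkm : k ≠ m) (x : Fin 3) :
    x = i ∨ x = k ∨ x = m := by
  revert i k m x; decide

theorem sum_of_distinct {i k m : Fin 3} (hik : i ≠ k) (him : i ≠ m) (hkm : k ≠ m)
    (f : Fin 3 → ℝ) : ∑ x, f x = f i + f k + f m := by
  have h : (Finset.univ : Finset (Fin 3)) = {i, k, m} := by
    ext x; simpa using eq_or_eq_or_eq hik him hkm x
  rw [h, Finset.sum_insert (by simp [hik, him]), Finset.sum_insert (by simp [hkm]),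
    Finset.sum_singleton]
  ring

/-- The linear functional with coefficient vector `γ`. -/
noncomputable def functional (γ : Fin 3 → ℝ) : (Fin 3 → ℝ) →L[ℝ] ℝ :=
  ∑ i, γ i • ContinuousLinearMap.proj i

@[simp] theorem functional_apply (γ x : Fin 3 → ℝ) : functional γ x = ∑ i, γ i * x i := by
  simp [functional]

/-- The plane through the origin with normal vector `γ`. -/
noncomputable def normalPlane (γ : Fin 3 → ℝ) : Submodule ℝ (Fin 3 → ℝ) :=
  LinearMap.ker (functional γ).toLinearMap

theorem mem_normalPlane {γ x : Fin 3 → ℝ} : x ∈ normalPlane γ ↔ ∑ i, γ i * x i = 0 := by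
  simp [normalPlane]

theorem exists_functional_eq (l : (Fin 3 → ℝ) →ₗ[ℝ] ℝ) :
    ∃ n : Fin 3 → ℝ, ∀ x, l x = ∑ i, n i * x i := by
  refine ⟨fun i => l (Pi.single i 1), fun x => ?_⟩
  rw [LinearMap.pi_apply_eq_sum_univ l x]
  refine Finset.sum_congr rfl fun i _ => ?_
  rw [smul_eq_mul, mul_comm]
  congr 2
  ext k
  simp [Pi.single_apply, eq_comm]

theorem finrank_normalPlane {γ : Fin 3 → ℝ} (hγ : γ ≠ 0) :
    Module.finrank ℝ (normalPlane γ) = 2 := by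
  have h := (functional γ).toLinearMap.finrank_range_add_finrank_ker
  have hs : LinearMap.range (functional γ).toLinearMap = ⊤ := by
    apply LinearMap.range_eq_top.2
    obtain ⟨i, hi⟩ := Function.ne_iff.1 hγ
    refine LinearMap.surjective fun h0 => hi ?_
    have := LinearMap.congr_fun h0 (Pi.single i 1)
    simpa [Pi.single_apply] using this
  rw [hs, finrank_top] at h
  simp only [Module.finrank_self, Module.finrank_fintype_fun_eq_card, Fintype.card_fin] at h
  change Module.finrank ℝ (LinearMap.ker (functional γ).toLinearMap) = 2
  omega

theorem ne_zero_of_pos {γ : Fin 3 → ℝ} (hγ : ∀ i, 0 < γ i) : γ ≠ 0 := fun h =>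
  (hγ 0).ne' (congrFun h 0)

/-- The vectors γ_k e_i − γ_i e_k lie in the first plane; membership in the second makes δ
proportional to γ, and the sums fix the factor. -/
theorem eq_of_normalPlane_eq {γ δ : Fin 3 → ℝ} (hγ : ∑ i, γ i = 1) (hδ : ∑ i, δ i = 1)
    (h : normalPlane γ = normalPlane δ) : γ = δ := by
  have key : ∀ i k, δ i * γ k = δ k * γ i := by
    intro i k
    have h1 : (Pi.single i (γ k) - Pi.single k (γ i) : Fin 3 → ℝ) ∈ normalPlane γ := by
      rw [mem_normalPlane]
      simp [mul_sub, Finset.sum_sub_distrib, Pi.single_apply, mul_comm]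
    rw [h, mem_normalPlane] at h1
    simp [mul_sub, Finset.sum_sub_distrib, Pi.single_apply] at h1
    linarith
  ext i
  have : ∑ k, δ i * γ k = ∑ k, δ k * γ i := Finset.sum_congr rfl fun k _ => key i k
  rw [← Finset.mul_sum, ← Finset.sum_mul, hγ, hδ] at this
  linarith

theorem sum_pos_of_pos {x : Fin 3 → ℝ} (hx : ∀ i, 0 < x i) : 0 < ∑ i, x i :=
  Finset.sum_pos (fun i _ => hx i) Finset.univ_nonempty

theorem normalize_mem_interiorRNS {x : Fin 3 → ℝ} (hx : ∀ i, 0 < x i) :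
    normalize x ∈ interiorRNS := by
  have h := sum_pos_of_pos hx
  refine ⟨fun i => div_pos (hx i) h, ?_⟩
  simp only [normalize]
  rw [← Finset.sum_div, div_self h.ne']

theorem RD_mem_interiorRNS {x : Fin 3 → ℝ} (hx : ∀ i, 0 < x i) : RD x ∈ interiorRNS :=
  normalize_mem_interiorRNS fun i => inv_pos.2 (hx i)

theorem RD_RD {x : Fin 3 → ℝ} (hx : x ∈ interiorRNS) : RD (RD x) = x := by
  have h := sum_pos_of_pos fun i => inv_pos.2 (hx.1 i)
  ext i
  simp only [RD, normalize, inv_div, div_inv_eq_mul]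
  rw [← Finset.mul_sum, hx.2, mul_one, mul_div_cancel_left₀ _ h.ne']

/-! ### Maximizers of weighted sums and the dimension of their faces -/

section

variable {M : Type*}

/-- Player `i` is among the players whose weighted value of item `j` is the largest. -/
def IsBest (a : Fin 3 → M → ℝ) (γ : Fin 3 → ℝ) (j : M) (i : Fin 3) : Prop :=
  ∀ k, γ k * a k j ≤ γ i * a i j

theorem exists_isBest (a : Fin 3 → M → ℝ) (γ : Fin 3 → ℝ) (j : M) : ∃ i, IsBest a γ j i :=
  Finite.exists_max fun i => γ i * a i j

/-- Since the weights are proportional to 1/β_i, the comparison is one of the ratios a_ij / β_i,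
here with denominators cleared. All later arguments multiply such inequalities. -/
theorem isBest_RD {a : Fin 3 → M → ℝ} {β : Fin 3 → ℝ} (hβ : β ∈ interiorRNS) {j : M}
    {i : Fin 3} : IsBest a (RD β) j i ↔ ∀ k, a k j * β i ≤ a i j * β k := by
  have h := sum_pos_of_pos fun i => inv_pos.2 (hβ.1 i)
  refine forall_congr' fun k => ?_
  have hi := hβ.1 i
  have hk := hβ.1 k
  simp only [RD, normalize]
  rw [div_mul_eq_mul_div, div_mul_eq_mul_div, div_le_div_iff_of_pos_right h, inv_mul_eq_div,
    inv_mul_eq_div, div_le_div_iff₀ hk hi]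

/-- The allocation that gives every item `j` to player `b j`. -/
def pureAllocation [DecidableEq M] (b : M → Fin 3) : Fin 3 → M → ℝ :=
  fun i j => if b j = i then 1 else 0

theorem isAllocation_pureAllocation [DecidableEq M] (b : M → Fin 3) :
    IsAllocation (pureAllocation b) := by
  refine ⟨fun i j => ?_, fun j => ?_⟩
  · unfold pureAllocation; split_ifs <;> norm_num
  · simp [pureAllocation]

theorem IsAllocation.combine {X Y : Fin 3 → M → ℝ} (hX : IsAllocation X) (hY : IsAllocation Y)
    {s t : ℝ} (hs : 0 ≤ s) (ht : 0 ≤ t) (hst : s + t = 1) : IsAllocation (s • X + t • Y) := by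
  refine ⟨fun i j => ?_, fun j => ?_⟩
  · have := hX.1 i j
    have := hY.1 i j
    simp only [Pi.add_apply, Pi.smul_apply, smul_eq_mul]
    positivity
  · simp [Finset.sum_add_distrib, ← Finset.mul_sum, hX.2 j, hY.2 j, hst]

theorem update_isBest [DecidableEq M] {a : Fin 3 → M → ℝ} {γ : Fin 3 → ℝ} {b : M → Fin 3}
    (hb : ∀ j, IsBest a γ j (b j)) {j : M} {i : Fin 3} (hi : IsBest a γ j i) (l : M) :
    IsBest a γ l (Function.update b j i l) := by
  by_cases hl : l = j
  · subst hl; simpa using hi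
  · simpa [Function.update_of_ne hl] using hb l

variable [Fintype M]

theorem value_combine (a X Y : Fin 3 → M → ℝ) (s t : ℝ) :
    value a (s • X + t • Y) = s • value a X + t • value a Y := by
  ext i
  simp only [value, Pi.add_apply, Pi.smul_apply, smul_eq_mul, Finset.mul_sum,
    ← Finset.sum_add_distrib]
  exact Finset.sum_congr rfl fun j _ => by ring

theorem convex_IPS (a : Fin 3 → M → ℝ) : Convex ℝ (IPS a) := by
  rintro _ ⟨X, hX, rfl⟩ _ ⟨Y, hY, rfl⟩ s t hs ht hst
  exact ⟨_, hX.combine hY hs ht hst, value_combine a X Y s t⟩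

theorem supportSet_eq_functional (a : Fin 3 → M → ℝ) (γ : Fin 3 → ℝ) :
    supportSet a γ = {x | x ∈ IPS a ∧ ∀ y ∈ IPS a, functional γ y ≤ functional γ x} := by
  simp [supportSet]

theorem isExposed_supportSet (a : Fin 3 → M → ℝ) (γ : Fin 3 → ℝ) :
    IsExposed ℝ (IPS a) (supportSet a γ) := fun _ => ⟨functional γ, supportSet_eq_functional a γ⟩

theorem convex_supportSet (a : Fin 3 → M → ℝ) (γ : Fin 3 → ℝ) : Convex ℝ (supportSet a γ) :=
  (isExposed_supportSet a γ).convex (convex_IPS a)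

theorem sum_mul_value (a X : Fin 3 → M → ℝ) (γ : Fin 3 → ℝ) :
    ∑ i, γ i * value a X i = ∑ j, ∑ i, γ i * a i j * X i j := by
  simp only [value, Finset.mul_sum]
  rw [Finset.sum_comm]
  exact Finset.sum_congr rfl fun j _ => Finset.sum_congr rfl fun i _ => by ring

/-- Each item contributes at most its largest weighted value, and a pure allocation to best players
attains all these bounds at once. So a maximizer has equality item by item, and then share by share.
-/
theorem value_mem_supportSet {a X : Fin 3 → M → ℝ} {γ : Fin 3 → ℝ} (hX : IsAllocation X) :
    value a X ∈ supportSet a γ ↔ ∀ i j, X i j ≠ 0 → IsBest a γ j i := by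
  classical
  choose b hb using exists_isBest a γ
  have hle : ∀ Y, IsAllocation Y → ∀ j, ∑ i, γ i * a i j * Y i j ≤ γ (b j) * a (b j) j := by
    intro Y hY j
    calc ∑ i, γ i * a i j * Y i j ≤ ∑ i, γ (b j) * a (b j) j * Y i j :=
          Finset.sum_le_sum fun i _ => mul_le_mul_of_nonneg_right (hb j i) (hY.1 i j)
      _ = _ := by rw [← Finset.mul_sum, hY.2 j, mul_one]
  constructor
  · rintro ⟨-, hmax⟩ i j hij k
    have h1 := hmax _ ⟨_, isAllocation_pureAllocation b, rfl⟩
    rw [sum_mul_value, sum_mul_value] at h1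
    have h2 : ∀ j, ∑ i, γ i * a i j * pureAllocation b i j = γ (b j) * a (b j) j := by
      intro j; simp [pureAllocation]
    simp only [h2] at h1
    have h3 := (Finset.sum_eq_sum_iff_of_le fun j _ => hle X hX j).1
      (le_antisymm (Finset.sum_le_sum fun j _ => hle X hX j) h1) j (Finset.mem_univ j)
    have h4 : ∑ i, γ i * a i j * X i j = ∑ i, γ (b j) * a (b j) j * X i j := by
      rw [h3, ← Finset.mul_sum, hX.2 j, mul_one]
    have h5 := (Finset.sum_eq_sum_iff_of_le fun i _ =>
      mul_le_mul_of_nonneg_right (hb j i) (hX.1 i j)).1 h4 i (Finset.mem_univ i)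
    rw [mul_right_cancel₀ hij h5]
    exact hb j k
  · intro h
    refine ⟨⟨X, hX, rfl⟩, ?_⟩
    rintro _ ⟨Y, hY, rfl⟩
    rw [sum_mul_value, sum_mul_value]
    refine Finset.sum_le_sum fun j _ => (hle Y hY j).trans_eq ?_
    rw [← mul_one (γ (b j) * a (b j) j), ← hX.2 j, Finset.mul_sum]
    refine Finset.sum_congr rfl fun i _ => ?_
    by_cases hij : X i j = 0
    · simp [hij]
    · rw [le_antisymm (h i j hij (b j)) (hb j i)]

theorem mem_supportSet {a : Fin 3 → M → ℝ} {γ x : Fin 3 → ℝ} :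
    x ∈ supportSet a γ ↔
      ∃ X, IsAllocation X ∧ value a X = x ∧ ∀ i j, X i j ≠ 0 → IsBest a γ j i := by
  constructor
  · intro hx
    obtain ⟨X, hX, rfl⟩ := hx.1
    exact ⟨X, hX, rfl, (value_mem_supportSet hX).1 hx⟩
  · rintro ⟨X, hX, rfl, h⟩
    exact (value_mem_supportSet hX).2 h

theorem value_pureAllocation_mem_supportSet [DecidableEq M] {a : Fin 3 → M → ℝ} {γ : Fin 3 → ℝ}
    {b : M → Fin 3} (hb : ∀ j, IsBest a γ j (b j)) :
    value a (pureAllocation b) ∈ supportSet a γ := by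
  refine (value_mem_supportSet (isAllocation_pureAllocation b)).2 fun i j hij => ?_
  have : b j = i := by
    by_contra h
    exact hij (by simp [pureAllocation, h])
  exact this ▸ hb j

/-- Handing one item from player k to player i changes only these two coordinates; such trades
provide the directions of a face. -/
theorem value_pureAllocation_update_sub [DecidableEq M] (a : Fin 3 → M → ℝ) (b : M → Fin 3)
    (j : M) (i k : Fin 3) :
    value a (pureAllocation (Function.update b j i)) -
        value a (pureAllocation (Function.update b j k)) =
      Pi.single i (a i j) - Pi.single k (a k j) := by
  ext x
  simp only [Pi.sub_apply, value, ← Finset.sum_sub_distrib, ← mul_sub]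
  rw [Finset.sum_eq_single j]
  · simp only [pureAllocation, Function.update_self, Pi.single_apply, eq_comm (a := x)]
    split_ifs <;> simp_all
  · intro l _ hl
    simp [pureAllocation, Function.update_of_ne hl]
  · simp

theorem vectorSpan_supportSet_le (a : Fin 3 → M → ℝ) (γ : Fin 3 → ℝ) :
    vectorSpan ℝ (supportSet a γ) ≤ normalPlane γ := by
  rw [vectorSpan, Submodule.span_le]
  rintro _ ⟨x, hx, y, hy, rfl⟩
  rw [SetLike.mem_coe, mem_normalPlane]
  simp only [vsub_eq_sub, Pi.sub_apply, mul_sub, Finset.sum_sub_distrib]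
  linarith [hx.2 y hy.1, hy.2 x hx.1]

theorem single_sub_single_mem_vectorSpan {a : Fin 3 → M → ℝ} {γ : Fin 3 → ℝ} {j : M}
    {i k : Fin 3} (hi : IsBest a γ j i) (hk : IsBest a γ j k) :
    (Pi.single i (a i j) - Pi.single k (a k j) : Fin 3 → ℝ) ∈
      vectorSpan ℝ (supportSet a γ) := by
  classical
  choose b hb using exists_isBest a γ
  rw [← value_pureAllocation_update_sub a b j i k]
  exact vsub_mem_vectorSpan ℝ
    (value_pureAllocation_mem_supportSet (update_isBest hb hi))
    (value_pureAllocation_mem_supportSet (update_isBest hb hk))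

/-- A face whose items connect all three players is two-dimensional. -/
theorem vectorSpan_supportSet_eq {a : Fin 3 → M → ℝ} (ha : ∀ i j, 0 < a i j) {γ : Fin 3 → ℝ}
    (hγ : ∀ i, 0 < γ i) {i k m : Fin 3} (hik : i ≠ k) (him : i ≠ m) (hkm : k ≠ m) {j l : M}
    (hji : IsBest a γ j i) (hjk : IsBest a γ j k) (hli : IsBest a γ l i)
    (hlm : IsBest a γ l m) : vectorSpan ℝ (supportSet a γ) = normalPlane γ := by
  refine le_antisymm (vectorSpan_supportSet_le a γ) fun v hv => ?_
  -- The coefficients are forced by coordinates k and m, each of which occurs in only one of the two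
  -- trades. Coordinate i then agrees because `v` and both trades are orthogonal to `γ`.
  have h1 := Submodule.smul_mem _ (-(v k / a k j)) (single_sub_single_mem_vectorSpan hji hjk)
  have h2 := Submodule.smul_mem _ (-(v m / a m l)) (single_sub_single_mem_vectorSpan hli hlm)
  convert add_mem h1 h2 using 1
  rw [mem_normalPlane, sum_of_distinct hik him hkm] at hv
  have e1 := le_antisymm (hji k) (hjk i)
  have e2 := le_antisymm (hli m) (hlm i)
  have p1 := ha k j
  have p2 := ha m l
  have p3 := hγ i
  ext x
  rcases eq_or_eq_or_eq hik him hkm x with rfl | rfl | rfl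
  · simp [hik, him]
    have r1 : a x j = γ k * a k j / γ x := by rw [e1]; field_simp
    have r2 : a x l = γ m * a m l / γ x := by rw [e2]; field_simp
    rw [r1, r2]
    field_simp
    linarith
  · simp [hik.symm, hkm, p1.ne']
  · simp [him.symm, hkm.symm, p2.ne']

/-- On a two-dimensional face no player is isolated. -/
theorem exists_shared_item {a : Fin 3 → M → ℝ} {γ : Fin 3 → ℝ} (hγ : ∀ i, 0 < γ i)
    (h : vectorSpan ℝ (supportSet a γ) = normalPlane γ) (i : Fin 3) :
    ∃ k, k ≠ i ∧ ∃ j, IsBest a γ j i ∧ IsBest a γ j k := by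
  classical
  by_contra! hcon
  choose b hb using exists_isBest a γ
  -- If i ties with nobody, each item goes to i entirely or not at all, so coordinate i is constant
  -- on the face. The plane, however, contains γ_k e_i − γ_i e_k, whose coordinate i is positive.
  have hconst : ∀ x ∈ supportSet a γ, x i = ∑ j, if IsBest a γ j i then a i j else 0 := by
    intro x hx
    obtain ⟨X, hX, rfl, hXb⟩ := mem_supportSet.1 hx
    refine Finset.sum_congr rfl fun j _ => ?_
    split_ifs with hj
    · have h0 : ∀ k, k ≠ i → X k j = 0 := fun k hk => by
        by_contra hne
        exact hcon k hk j hj (hXb k j hne)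
      have := hX.2 j
      rw [Finset.sum_eq_single i (fun k _ hk => h0 k hk) (by simp)] at this
      rw [this, mul_one]
    · have : X i j = 0 := by
        by_contra hne
        exact hj (hXb i j hne)
      rw [this, mul_zero]
  obtain ⟨k, hk, -⟩ := exists_third i i
  have hv : (Pi.single i (γ k) - Pi.single k (γ i) : Fin 3 → ℝ) ∈ normalPlane γ := by
    rw [mem_normalPlane]
    simp [mul_sub, Finset.sum_sub_distrib, Pi.single_apply, mul_comm]
  have hle : vectorSpan ℝ (supportSet a γ) ≤
      LinearMap.ker (LinearMap.proj (R := ℝ) (φ := fun _ : Fin 3 => ℝ) i) := by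
    rw [vectorSpan, Submodule.span_le]
    rintro _ ⟨x, hx, y, hy, rfl⟩
    simp [hconst x hx, hconst y hy]
  have := hle (h ▸ hv)
  simp [hk.symm] at this
  exact (hγ k).ne' this

end

/-! ### Supporting segments as ties between two players -/

section

variable {M : Type*}

/-- Moving from the item towards e_m scales the other two coordinates by one factor s and only adds
to s times coordinate m. So the ratios a_ij / β_i stay tied off m, and that of m can only drop below
them. -/
theorem mem_supportingSegment {a : Fin 3 → M → ℝ} (ha : ∀ i j, 0 < a i j) {β : Fin 3 → ℝ}
    (hβ : β ∈ interiorRNS) {j : M} {m : Fin 3} :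
    β ∈ supportingSegment a j m ↔ ∀ i, i ≠ m → IsBest a (RD β) j i := by
  have hs : 0 < ∑ i, a i j := sum_pos_of_pos fun i => ha i j
  obtain ⟨i, him, -⟩ := exists_third m m
  obtain ⟨k, hki, hkm⟩ := exists_third i m
  have e1 := sum_of_distinct hki.symm him hkm fun i => a i j
  have e2 := sum_of_distinct hki.symm him hkm β
  rw [hβ.2] at e2
  have hcases := eq_or_eq_or_eq hki.symm him hkm
  have hβi := hβ.1 i
  have hβk := hβ.1 k
  have hai := ha i j
  have hak := ha k j
  simp only [isBest_RD hβ]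
  constructor
  · rintro ⟨s, t, hs0, ht0, hst, rfl⟩ x hx y
    have hval : ∀ z, z ≠ m →
        (s • item a j + t • corner m) z = s * (a z j / ∑ i, a i j) := by
      intro z hz
      simp [item, normalize, corner, hz]
    rw [hval x hx]
    by_cases hy : y = m
    · subst hy
      have : (s • item a j + t • corner y) y = s * (a y j / ∑ i, a i j) + t := by
        simp [item, normalize, corner]
      rw [this]
      have h1 : a y j * (s * (a x j / ∑ i, a i j)) = a x j * (s * (a y j / ∑ i, a i j)) := by
        ring
      rw [h1]
      exact mul_le_mul_of_nonneg_left (by linarith) (ha x j).le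
    · rw [hval y hy]
      apply le_of_eq
      ring
  · intro h
    have h1 : a k j * β i = a i j * β k := le_antisymm (h i him k) (h k hkm i)
    have h2 := h i him m
    have hle : (∑ i, a i j) * β i ≤ a i j := by
      rw [e1]
      nlinarith
    -- The only factor that matches coordinate i; the tie gives coordinate k, and the coordinate sum
    -- gives m.
    set s := (∑ i, a i j) * β i / a i j with hsdef
    have hs1 : s ≤ 1 := by rw [hsdef, div_le_one hai]; exact hle
    have vi : s * (a i j / ∑ i, a i j) = β i := by rw [hsdef]; field_simp
    have vk : s * (a k j / ∑ i, a i j) = β k := by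
      rw [hsdef]; field_simp; linarith
    have vm : s * (a m j / ∑ i, a i j) + (1 - s) = β m := by
      have : s * (a i j / ∑ i, a i j) + s * (a k j / ∑ i, a i j) +
          s * (a m j / ∑ i, a i j) = s := by
        rw [← mul_add, ← mul_add, ← add_div, ← add_div, ← e1, div_self hs.ne', mul_one]
      linarith
    refine ⟨s, 1 - s, by positivity, by linarith, by ring, ?_⟩
    ext x
    rcases hcases x with rfl | rfl | rfl
    · simpa [item, normalize, corner, him] using vi
    · simpa [item, normalize, corner, hkm] using vk
    · simpa [item, normalize, corner] using vm

theorem item_mem_interiorRNS {a : Fin 3 → M → ℝ} (ha : ∀ i j, 0 < a i j) (j : M) :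
    item a j ∈ interiorRNS := normalize_mem_interiorRNS fun i => ha i j

theorem item_mem_supportingSegment_iff {a : Fin 3 → M → ℝ} (ha : ∀ i j, 0 < a i j) {j l : M}
    {p : Fin 3} : item a l ∈ supportingSegment a j p ↔
      ∀ i, i ≠ p → ∀ k, a k j * a i l ≤ a i j * a k l := by
  have hs : 0 < ∑ i, a i l := sum_pos_of_pos fun i => ha i l
  rw [mem_supportingSegment ha (item_mem_interiorRNS ha l)]
  simp only [isBest_RD (item_mem_interiorRNS ha l)]
  simp only [item, normalize, ← mul_div_assoc]
  simp only [div_le_div_iff_of_pos_right hs]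

/-- Two supporting segments of one item, to different corners, meet only in the item. -/
theorem eq_item_of_mem_supportingSegment {a : Fin 3 → M → ℝ} (ha : ∀ i j, 0 < a i j)
    {β : Fin 3 → ℝ} (hβ : β ∈ interiorRNS) {j : M} {m n : Fin 3} (hmn : m ≠ n)
    (hm : β ∈ supportingSegment a j m) (hn : β ∈ supportingSegment a j n) : β = item a j := by
  rw [mem_supportingSegment ha hβ] at hm hn
  have hall : ∀ i, IsBest a (RD β) j i := fun i => by
    by_cases h : i = m
    · exact hn i (h ▸ hmn)
    · exact hm i h
  simp only [isBest_RD hβ] at hall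
  have hs : 0 < ∑ i, a i j := sum_pos_of_pos fun i => ha i j
  ext i
  have h : ∑ k, a k j * β i = ∑ k, a i j * β k :=
    Finset.sum_congr rfl fun k _ => le_antisymm (hall i k) (hall k i)
  rw [← Finset.sum_mul, ← Finset.mul_sum, hβ.2, mul_one] at h
  simp only [item, normalize]
  rw [eq_div_iff hs.ne', mul_comm, h]

theorem item_mem_supportingSegment (a : Fin 3 → M → ℝ) (j : M) (m : Fin 3) :
    item a j ∈ supportingSegment a j m := left_mem_segment ℝ _ _

/-- If `l` lies on a supporting segment of `j`, then a point on supporting segments of `j` and `l`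
towards different corners coincides with one of the two items. -/
theorem eq_item_of_item_mem {a : Fin 3 → M → ℝ} (ha : ∀ i j, 0 < a i j)
    {β : Fin 3 → ℝ} (hβ : β ∈ interiorRNS) {j l : M} {m n p : Fin 3} (hmn : m ≠ n)
    (hm : β ∈ supportingSegment a j m) (hn : β ∈ supportingSegment a l n)
    (hl : item a l ∈ supportingSegment a j p) : β = item a j ∨ β = item a l := by
  have hm0 := hm
  have hn0 := hn
  have hl' := (item_mem_supportingSegment_iff ha).1 hl
  rw [mem_supportingSegment ha hβ] at hm hn
  simp only [isBest_RD hβ] at hm hn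
  -- If p = m, then off m the points β and `item a l` are both proportional to `item a j`. The best
  -- player for l outside {m, n} thus ties with n, which puts β on a second segment of l.
  by_cases hpm : p = m
  · subst hpm
    right
    refine eq_item_of_mem_supportingSegment ha hβ hmn ?_ hn0
    rw [mem_supportingSegment ha hβ]
    simp only [isBest_RD hβ]
    obtain ⟨q, hqp, hqn⟩ := exists_third p n
    intro i hi k
    by_cases hin : i = n
    · subst hin
      have h1 := hm i hi q
      have h2 := hm q hqp i
      have h3 := hl' i hi q
      have h4 := hl' q hqp i
      have h5 := hn q hqn k
      have e1 : a q j * β i = a i j * β q := le_antisymm h1 h2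
      have e2 : a q j * a i l = a i j * a q l := le_antisymm h3 h4
      have e3 : a q l * β i = a i l * β q := by
        have : a q j * (a q l * β i) = a q j * (a i l * β q) := by
          calc a q j * (a q l * β i) = a q l * (a q j * β i) := by ring
            _ = (a i j * a q l) * β q := by rw [e1]; ring
            _ = _ := by rw [← e2]; ring
        exact mul_left_cancel₀ (ha q j).ne' this
      have : a q l * (a k l * β i) ≤ a q l * (a i l * β k) := by
        calc a q l * (a k l * β i) = a i l * (a k l * β q) := by
              rw [mul_left_comm, e3]; ring
          _ ≤ a i l * (a q l * β k) := mul_le_mul_of_nonneg_left h5 (ha i l).le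
          _ = _ := by ring
      exact le_of_mul_le_mul_left this (ha q l)
    · exact hn i hin k
  -- Here m turns out to be best for j too, which puts β on a second segment of j. The ratio a_kj /
  -- β_k is bounded through a_kj / a_kl and a_kl / β_k, directly if p = n and by way of player n
  -- otherwise.
  · left
    refine eq_item_of_mem_supportingSegment ha hβ (Ne.symm hpm) hm0 ?_
    rw [mem_supportingSegment ha hβ]
    simp only [isBest_RD hβ]
    intro i hi k
    by_cases him : i = m
    · subst him
      by_cases hpn : p = n
      · subst hpn
        have h1 := hl' i hi k
        have h2 := hn i hmn k
        have : a i l * (a k j * β i) ≤ a i l * (a i j * β k) := by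
          calc a i l * (a k j * β i) = (a k j * a i l) * β i := by ring
            _ ≤ (a i j * a k l) * β i := mul_le_mul_of_nonneg_right h1 (hβ.1 i).le
            _ = a i j * (a k l * β i) := by ring
            _ ≤ a i j * (a i l * β k) := mul_le_mul_of_nonneg_left h2 (ha i j).le
            _ = _ := by ring
        exact le_of_mul_le_mul_left this (ha i l)
      · have h1 := hl' i hi n
        have h2 := hn i hmn n
        have h3 := hm n hmn.symm k
        have : a n l * β n * (a k j * β i) ≤ a n l * β n * (a i j * β k) := by
          calc a n l * β n * (a k j * β i) = (a n l * β i) * (a k j * β n) := by ring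
            _ ≤ (a i l * β n) * (a n j * β k) :=
              mul_le_mul h2 h3 (mul_nonneg (ha k j).le (hβ.1 n).le)
                (mul_nonneg (ha i l).le (hβ.1 n).le)
            _ = (a n j * a i l) * (β n * β k) := by ring
            _ ≤ (a i j * a n l) * (β n * β k) :=
              mul_le_mul_of_nonneg_right h1 (mul_nonneg (hβ.1 n).le (hβ.1 k).le)
            _ = _ := by ring
        exact le_of_mul_le_mul_left this (mul_pos (ha n l) (hβ.1 n))
    · exact hm i him k

/-- If supporting segments of two items towards one corner meet in the interior, then one of the
items lies on the segment of the other. -/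
theorem item_mem_or_item_mem {a : Fin 3 → M → ℝ} (ha : ∀ i j, 0 < a i j) {β : Fin 3 → ℝ}
    (hβ : β ∈ interiorRNS) {j l : M} {m : Fin 3} (hj : β ∈ supportingSegment a j m)
    (hl : β ∈ supportingSegment a l m) :
    item a j ∈ supportingSegment a l m ∨ item a l ∈ supportingSegment a j m := by
  rw [mem_supportingSegment ha hβ] at hj hl
  simp only [isBest_RD hβ] at hj hl
  have heq : ∀ x, x ≠ m → ∀ y, y ≠ m → a x j * a y l = a y j * a x l := by
    intro x hx y hy
    have e1 : a x j * β y = a y j * β x := le_antisymm (hj y hy x) (hj x hx y)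
    have e2 : a x l * β y = a y l * β x := le_antisymm (hl y hy x) (hl x hx y)
    refine mul_right_cancel₀ (hβ.1 x).ne' ?_
    calc a x j * a y l * β x = a x j * (a y l * β x) := by ring
      _ = (a x j * β y) * a x l := by rw [← e2]; ring
      _ = _ := by rw [e1]; ring
  obtain ⟨q, hq, -⟩ := exists_third m m
  have key : ∀ u v : M, (∀ x, x ≠ m → ∀ y, y ≠ m → a x u * a y v = a y u * a x v) →
      a m u * a q v ≤ a q u * a m v → item a v ∈ supportingSegment a u m := by
    intro u v huv hle
    refine (item_mem_supportingSegment_iff ha).2 fun i hi k => ?_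
    by_cases hk : k = m
    · subst hk
      refine le_of_mul_le_mul_left ?_ (ha q u)
      calc a q u * (a k u * a i v) = a k u * (a q u * a i v) := by ring
        _ = a i u * (a k u * a q v) := by rw [huv q hq i hi]; ring
        _ ≤ a i u * (a q u * a k v) := mul_le_mul_of_nonneg_left hle (ha i u).le
        _ = _ := by ring
    · exact (huv k hk i hi).le
  -- Off m the two items are proportional, so only the weight of m relative to q differs; the item
  -- with the larger one is nearer to e_m.
  rcases le_total (a m j * a q l) (a q j * a m l) with h | h
  · exact Or.inr (key j l heq h)
  · refine Or.inl (key l j (fun x hx y hy => ?_) ?_)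
    · linarith [heq y hy x hx]
    · linarith

/-- The vertices are the interior points that lie on supporting segments towards two different
corners. -/
theorem mem_graphVertices {a : Fin 3 → M → ℝ} (ha : ∀ i j, 0 < a i j) {β : Fin 3 → ℝ} :
    β ∈ graphVertices a ↔ β ∈ interiorRNS ∧
      ∃ m n, m ≠ n ∧ ∃ j l, β ∈ supportingSegment a j m ∧ β ∈ supportingSegment a l n := by
  refine and_congr_right fun hβ => ⟨?_, ?_⟩
  · rintro (⟨j, rfl⟩ | ⟨j, k, hjk, i, i', hi, hi'⟩)
    · exact ⟨0, 1, by decide, j, j, item_mem_supportingSegment a j 0,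
        item_mem_supportingSegment a j 1⟩
    · refine ⟨i, i', ?_, j, k, hi, hi'⟩
      rintro rfl
      rcases item_mem_or_item_mem ha hβ hi hi' with h | h
      · exact hjk.1 _ h
      · exact hjk.2 _ h
  · rintro ⟨m, n, hmn, j, l, hj, hl⟩
    -- A point that is no item forces s-independence: otherwise `eq_item_of_item_mem` would make it
    -- one of the two items.
    by_contra! hcon
    refine hcon.2 j l ⟨fun p hp => ?_, fun p hp => ?_⟩ m n hj hl
    · rcases eq_item_of_item_mem ha hβ hmn.symm hl hj hp with h | h
      · exact hcon.1 _ h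
      · exact hcon.1 _ h
    · rcases eq_item_of_item_mem ha hβ hmn hj hl hp with h | h
      · exact hcon.1 _ h
      · exact hcon.1 _ h

end

/-! ### Vertices correspond to Pareto faces -/

section

variable {M : Type*} {a : Fin 3 → M → ℝ}

theorem isBest_of_mem_supportingSegment (ha : ∀ i j, 0 < a i j) {β : Fin 3 → ℝ}
    (hβ : β ∈ interiorRNS) {j : M} {m i : Fin 3} (h : β ∈ supportingSegment a j m)
    (hi : i ≠ m) : IsBest a (RD β) j i :=
  (mem_supportingSegment ha hβ).1 h i hi

theorem mem_supportingSegment_of_isBest (ha : ∀ i j, 0 < a i j) {β : Fin 3 → ℝ}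
    (hβ : β ∈ interiorRNS) {j : M} {i k m : Fin 3} (hik : i ≠ k) (him : i ≠ m) (hkm : k ≠ m)
    (hi : IsBest a (RD β) j i) (hk : IsBest a (RD β) j k) : β ∈ supportingSegment a j m := by
  refine (mem_supportingSegment ha hβ).2 fun x hx => ?_
  rcases eq_or_eq_or_eq hik him hkm x with rfl | rfl | rfl
  · exact hi
  · exact hk
  · exact absurd rfl hx

theorem RD_pos {β : Fin 3 → ℝ} (hβ : β ∈ interiorRNS) (i : Fin 3) : 0 < RD β i :=
  (RD_mem_interiorRNS hβ.1).1 i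

variable [Fintype M]

/-- Segments towards distinct corners m and n mean two different tied pairs, which have a player in
common and so connect all three. Conversely, if no player is isolated, player 0 ties with some k and
the remaining player with someone, which gives two different pairs. -/
theorem mem_graphVertices_iff_vectorSpan (ha : ∀ i j, 0 < a i j) {β : Fin 3 → ℝ}
    (hβ : β ∈ interiorRNS) :
    β ∈ graphVertices a ↔ vectorSpan ℝ (faceOf a β) = normalPlane (RD β) := by
  rw [mem_graphVertices ha, and_iff_right hβ]
  constructor
  · rintro ⟨m, n, hmn, j, l, hj, hl⟩
    obtain ⟨i, him, hin⟩ := exists_third m n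
    exact vectorSpan_supportSet_eq ha (RD_pos hβ) hin him hmn.symm
      (isBest_of_mem_supportingSegment ha hβ hj him)
      (isBest_of_mem_supportingSegment ha hβ hj hmn.symm)
      (isBest_of_mem_supportingSegment ha hβ hl hin)
      (isBest_of_mem_supportingSegment ha hβ hl hmn)
  · intro h
    obtain ⟨k, hk, j, hj0, hjk⟩ := exists_shared_item (RD_pos hβ) h 0
    obtain ⟨m, hm0, hmk⟩ := exists_third 0 k
    obtain ⟨n, hn, l, hlm, hln⟩ := exists_shared_item (RD_pos hβ) h m
    obtain ⟨p, hpm, hpn⟩ := exists_third m n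
    exact ⟨m, p, hpm.symm, j, l,
      mem_supportingSegment_of_isBest ha hβ hk.symm hm0.symm hmk.symm hj0 hjk,
      mem_supportingSegment_of_isBest ha hβ hn.symm hpm.symm hpn.symm hlm hln⟩

theorem supportSet_subset_paretoBoundary {γ : Fin 3 → ℝ} (hγ : ∀ i, 0 < γ i) :
    supportSet a γ ⊆ paretoBoundary a := by
  intro x hx
  obtain ⟨X, hX, rfl⟩ := hx.1
  refine ⟨X, ⟨hX, ?_⟩, rfl⟩
  rintro ⟨Y, hY, hle, i, hi⟩
  refine (hx.2 _ ⟨Y, hY, rfl⟩).not_gt ?_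
  exact Finset.sum_lt_sum (fun k _ => mul_le_mul_of_nonneg_left (hle k) (hγ k).le)
    ⟨i, Finset.mem_univ i, mul_lt_mul_of_pos_left hi (hγ i)⟩

theorem isParetoFace_faceOf (ha : ∀ i j, 0 < a i j) {β : Fin 3 → ℝ}
    (hβ : β ∈ graphVertices a) : IsParetoFace a (faceOf a β) := by
  refine ⟨isExposed_supportSet _ _, ?_, supportSet_subset_paretoBoundary (RD_pos hβ.1)⟩
  rw [(mem_graphVertices_iff_vectorSpan ha hβ.1).1 hβ]
  exact finrank_normalPlane (ne_zero_of_pos (RD_pos hβ.1))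

theorem RD_injOn {β β' : Fin 3 → ℝ} (hβ : β ∈ interiorRNS) (hβ' : β' ∈ interiorRNS)
    (h : normalPlane (RD β) = normalPlane (RD β')) : β = β' := by
  rw [← RD_RD hβ, ← RD_RD hβ',
    eq_of_normalPlane_eq (RD_mem_interiorRNS hβ.1).2 (RD_mem_interiorRNS hβ'.1).2 h]

theorem faceOf_injOn (ha : ∀ i j, 0 < a i j) : Set.InjOn (faceOf a) (graphVertices a) := by
  intro β hβ β' hβ' h
  refine RD_injOn hβ.1 hβ'.1 ?_
  rw [← (mem_graphVertices_iff_vectorSpan ha hβ.1).1 hβ,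
    ← (mem_graphVertices_iff_vectorSpan ha hβ'.1).1 hβ', h]

theorem eq_of_mem_paretoBoundary_of_le {x y : Fin 3 → ℝ} (hx : x ∈ paretoBoundary a)
    (hy : y ∈ IPS a) (hle : x ≤ y) : x = y := by
  obtain ⟨X, ⟨-, hX⟩, rfl⟩ := hx
  obtain ⟨Y, hY, rfl⟩ := hy
  by_contra hne
  refine hX ⟨Y, hY, hle, ?_⟩
  by_contra! hge
  exact hne (le_antisymm hle hge)

/-- Any point of the intrinsic interior serves. The bound `ε ≤ 1` is there so that `x + ε • (y - x)`
stays in a convex set that contains `x` and `y`. -/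
theorem exists_forall_add_smul_mem {F : Set (Fin 3 → ℝ)} (hF : Convex ℝ F) (hne : F.Nonempty) :
    ∃ x ∈ F, ∀ d ∈ vectorSpan ℝ F, ∃ ε : ℝ, 0 < ε ∧ ε ≤ 1 ∧ x + ε • d ∈ F := by
  obtain ⟨x, hx⟩ := hne.intrinsicInterior hF
  refine ⟨x, intrinsicInterior_subset hx, fun d hd => ?_⟩
  obtain ⟨y, hy, rfl⟩ := mem_intrinsicInterior.1 hx
  have hmem : ∀ t : ℝ, (y : Fin 3 → ℝ) + t • d ∈ affineSpan ℝ F := fun t => by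
    rw [add_comm]
    exact AffineSubspace.vadd_mem_of_mem_direction
      (by rw [direction_affineSpan]; exact Submodule.smul_mem _ t hd) y.2
  have hcont : Continuous fun t : ℝ => (⟨y + t • d, hmem t⟩ : affineSpan ℝ F) := by
    fun_prop
  have hev : ∀ᶠ t in nhds (0 : ℝ), (y : Fin 3 → ℝ) + t • d ∈ F := by
    have h0 : (⟨y + (0 : ℝ) • d, hmem 0⟩ : affineSpan ℝ F) = y := by simp
    have := hcont.continuousAt.preimage_mem_nhds (x := (0 : ℝ))
      (by rw [h0]; exact mem_interior_iff_mem_nhds.1 hy)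
    exact this
  obtain ⟨δ, hδ, hball⟩ := Metric.eventually_nhds_iff.1 hev
  refine ⟨min (δ / 2) 1, by positivity, min_le_right _ _, hball ?_⟩
  rw [Real.dist_eq, sub_zero, abs_of_pos (by positivity)]
  exact (min_le_left _ _).trans_lt (by linarith)

/-- A plane without nonzero nonnegative vectors has a positive normal vector. -/
theorem exists_pos_normal {P : Submodule ℝ (Fin 3 → ℝ)} (hP : Module.finrank ℝ P = 2)
    (h : ∀ v ∈ P, 0 ≤ v → v = 0) : ∃ n, (∀ i, 0 < n i) ∧ P = normalPlane n := by
  have hlt : P < ⊤ := by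
    refine lt_top_iff_ne_top.2 fun htop => ?_
    rw [htop, finrank_top] at hP
    simp at hP
  obtain ⟨f, hf, hle⟩ := Submodule.exists_le_ker_of_lt_top P hlt
  obtain ⟨n, hn⟩ := exists_functional_eq f
  have hn0 : n ≠ 0 := by
    rintro rfl
    exact hf (LinearMap.ext fun x => by simp [hn])
  have hPn : P = normalPlane n := by
    refine Submodule.eq_of_le_of_finrank_eq (fun x hx => ?_)
      (by rw [hP, finrank_normalPlane hn0])
    rw [mem_normalPlane, ← hn]
    exact hle hx
  -- A vanishing coordinate would put e_i into `P`, and two coordinates of opposite sign would put a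
  -- nonnegative combination of e_i and e_k there.
  have hneq : ∀ i, n i ≠ 0 := fun i hi => by
    have := h (Pi.single i 1) (by rw [hPn, mem_normalPlane]; simp [Pi.single_apply, hi])
      (Pi.single_nonneg.2 zero_le_one)
    simpa using congrFun this i
  have hsign : ∀ i k, 0 < n i → 0 < n k := fun i k hi => by
    by_contra hk
    have hk' : n k < 0 := lt_of_le_of_ne (not_lt.1 hk) (hneq k)
    have hik : i ≠ k := by rintro rfl; exact hk hi
    have := h (Pi.single i (-n k) + Pi.single k (n i))
      (by
        rw [hPn, mem_normalPlane]
        simp [mul_add, Finset.sum_add_distrib, Pi.single_apply, mul_comm])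
      (add_nonneg (Pi.single_nonneg.2 (by linarith)) (Pi.single_nonneg.2 hi.le))
    have := congrFun this k
    simp [hik.symm] at this
    exact hi.ne' this
  by_cases h0 : 0 < n 0
  · exact ⟨n, fun k => hsign 0 k h0, hPn⟩
  · refine ⟨-n, fun k => ?_, ?_⟩
    · have : ¬ 0 < n k := fun hk => h0 (hsign k 0 hk)
      have := lt_of_le_of_ne (not_lt.1 this) (hneq k)
      simpa using this
    · rw [hPn]
      ext x
      simp [mem_normalPlane]

/-- At a relatively interior point `x` of the face, a nonnegative direction of the face would be a
Pareto improvement, so the plane of the face has a positive normal `n`. This `n` supports the whole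
polytope: a point `y` above the plane could be pushed down along `n` onto it, and a small step from
`x` towards the pushed point stays in `F` but is dominated by the same step towards `y`. -/
theorem IsParetoFace.exists_pos_normal {F : Set (Fin 3 → ℝ)} (hF : IsParetoFace a F) :
    ∃ n, (∀ i, 0 < n i) ∧ vectorSpan ℝ F = normalPlane n ∧ F = supportSet a n := by
  obtain ⟨hexp, hrank, hpar⟩ := hF
  have hne : F.Nonempty := by
    by_contra h
    rw [Set.not_nonempty_iff_eq_empty.1 h, vectorSpan_empty] at hrank
    simp at hrank
  have hconv := hexp.convex (convex_IPS a)
  obtain ⟨l, hl⟩ := hexp hne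
  obtain ⟨x, hx, hrel⟩ := exists_forall_add_smul_mem hconv hne
  have hsub : F ⊆ IPS a := hexp.subset
  obtain ⟨n, hn, hspan⟩ := FairDivision.exists_pos_normal hrank fun v hv hv0 => by
    obtain ⟨ε, hε, -, hmem⟩ := hrel v hv
    have := eq_of_mem_paretoBoundary_of_le (hpar hx) (hsub hmem)
      (le_add_of_nonneg_right (smul_nonneg hε.le hv0))
    have h0 : ε • v = 0 := by simpa using this
    exact (smul_eq_zero.1 h0).resolve_left hε.ne'
  have hmax : ∀ y ∈ IPS a, ∑ i, n i * y i ≤ ∑ i, n i * x i := by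
    intro y hy
    by_contra! hlt
    have hnn : 0 < ∑ i, n i * n i := sum_pos_of_pos fun i => mul_pos (hn i) (hn i)
    -- Chosen so that `y - x - c • n` is orthogonal to `n`.
    set c := (∑ i, n i * y i - ∑ i, n i * x i) / ∑ i, n i * n i with hc
    have hcpos : 0 < c := div_pos (by linarith) hnn
    obtain ⟨ε, hε, hε1, hmem⟩ := hrel (y - x - c • n) (by
      rw [hspan, mem_normalPlane]
      have : ∑ i, n i * (y - x - c • n) i =
          ∑ i, n i * y i - ∑ i, n i * x i - c * ∑ i, n i * n i := by
        rw [Finset.mul_sum, ← Finset.sum_sub_distrib, ← Finset.sum_sub_distrib]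
        exact Finset.sum_congr rfl fun i _ => by
          simp only [Pi.sub_apply, Pi.smul_apply, smul_eq_mul]; ring
      rw [this, hc, div_mul_cancel₀ _ hnn.ne', sub_self])
    have hmem' : x + ε • (y - x) ∈ IPS a :=
      (convex_IPS a).add_smul_sub_mem (hsub hx) hy ⟨hε.le, hε1⟩
    have hlt : ∀ i, (x + ε • (y - x - c • n)) i < (x + ε • (y - x)) i := fun i => by
      have := mul_pos hε (mul_pos hcpos (hn i))
      simp only [Pi.add_apply, Pi.sub_apply, Pi.smul_apply, smul_eq_mul]
      nlinarith
    have := eq_of_mem_paretoBoundary_of_le (hpar hmem) hmem' fun i => (hlt i).le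
    exact (hlt 0).ne (congrFun this 0)
  have hle : vectorSpan ℝ F ≤ LinearMap.ker l.toLinearMap := by
    rw [vectorSpan, Submodule.span_le]
    rintro _ ⟨y, hy, z, hz, rfl⟩
    rw [hl] at hy hz
    have := le_antisymm (hy.2 z hz.1) (hz.2 y hy.1)
    simp [this]
  refine ⟨n, hn, hspan, Set.Subset.antisymm (fun y hy => ⟨hsub hy, fun z hz => ?_⟩) ?_⟩
  · have := vsub_mem_vectorSpan ℝ hx hy
    rw [hspan, mem_normalPlane] at this
    simp only [vsub_eq_sub, Pi.sub_apply, mul_sub, Finset.sum_sub_distrib] at this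
    linarith [hmax z hz]
  · rintro y ⟨hy, hymax⟩
    -- The exposing functional `l` is constant along the plane of `F`, so every point of the
    -- polytope in that plane belongs to `F`.
    have hyx : y - x ∈ vectorSpan ℝ F := by
      rw [hspan, mem_normalPlane]
      simp only [Pi.sub_apply, mul_sub, Finset.sum_sub_distrib]
      linarith [hmax y hy, hymax x (hsub hx)]
    have h0 : l y = l x := by
      have := hle hyx
      simpa [sub_eq_zero] using this
    rw [hl] at hx ⊢
    exact ⟨hy, fun z hz => h0 ▸ hx.2 z hz⟩

theorem normalPlane_smul {c : ℝ} (hc : c ≠ 0) (γ : Fin 3 → ℝ) :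
    normalPlane (c • γ) = normalPlane γ := by
  ext x
  simp [mem_normalPlane, mul_assoc, ← Finset.mul_sum, hc]

theorem supportSet_smul {c : ℝ} (hc : 0 < c) (γ : Fin 3 → ℝ) :
    supportSet a (c • γ) = supportSet a γ := by
  ext x
  simp [supportSet, mul_assoc, ← Finset.mul_sum, hc]

theorem normalize_eq_smul (x : Fin 3 → ℝ) : normalize x = (∑ k, x k)⁻¹ • x := by
  ext i
  simp [normalize, div_eq_inv_mul]

theorem faceOf_surjOn (ha : ∀ i j, 0 < a i j) :
    Set.SurjOn (faceOf a) (graphVertices a) {F | IsParetoFace a F} := by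
  intro F hF
  obtain ⟨n, hn, hspan, hFn⟩ := hF.exists_pos_normal
  have hs := inv_pos.2 (sum_pos_of_pos hn)
  have hN := normalize_mem_interiorRNS hn
  have hface : faceOf a (RD (normalize n)) = F := by
    rw [faceOf, RD_RD hN, normalize_eq_smul, supportSet_smul hs, hFn]
  refine ⟨RD (normalize n), ?_, hface⟩
  rw [mem_graphVertices_iff_vectorSpan ha (RD_mem_interiorRNS hN.1), hface, RD_RD hN,
    normalize_eq_smul, normalPlane_smul hs.ne', hspan]

theorem bijOn_faceOf (ha : ∀ i j, 0 < a i j) :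
    Set.BijOn (faceOf a) (graphVertices a) {F | IsParetoFace a F} :=
  ⟨fun _ h => isParetoFace_faceOf ha h, faceOf_injOn ha, faceOf_surjOn ha⟩

end

/-! ### Arcs and common edges -/

section

variable {M : Type*} {a : Fin 3 → M → ℝ}

theorem openSegment_subset_interiorRNS {v w : Fin 3 → ℝ} (hv : v ∈ interiorRNS)
    (hw : w ∈ interiorRNS) : openSegment ℝ v w ⊆ interiorRNS := by
  rintro _ ⟨s, t, hs, ht, hst, rfl⟩
  refine ⟨fun i => ?_, ?_⟩
  · have := hv.1 i
    have := hw.1 i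
    simp only [Pi.add_apply, Pi.smul_apply, smul_eq_mul]
    positivity
  · simp [Finset.sum_add_distrib, ← Finset.mul_sum, hv.2, hw.2, hst]

/-- On a supporting segment, comparisons between the two players that share the item do not
depend on the point. -/
theorem le_of_mem_supportingSegment (ha : ∀ i j, 0 < a i j) {v w : Fin 3 → ℝ}
    (hv : v ∈ interiorRNS) (hw : w ∈ interiorRNS) {j l : M} {m i k : Fin 3}
    (hvj : v ∈ supportingSegment a j m) (hwj : w ∈ supportingSegment a j m)
    (hi : i ≠ m) (hk : k ≠ m) (h : a k l * v i ≤ a i l * v k) : a k l * w i ≤ a i l * w k := by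
  rw [mem_supportingSegment ha hv] at hvj
  rw [mem_supportingSegment ha hw] at hwj
  simp only [isBest_RD hv, isBest_RD hw] at hvj hwj
  have e1 : a k j * v i = a i j * v k := le_antisymm (hvj i hi k) (hvj k hk i)
  have e2 : a k j * w i = a i j * w k := le_antisymm (hwj i hi k) (hwj k hk i)
  -- Players i and k tie for j at both points, so the ratio of these two coordinates is that of j at
  -- both.
  have e3 : v i * w k = v k * w i := by
    refine mul_left_cancel₀ (ha k j).ne' ?_
    calc a k j * (v i * w k) = (a k j * v i) * w k := by ring
      _ = (a i j * w k) * v k := by rw [e1]; ring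
      _ = _ := by rw [← e2]; ring
  refine le_of_mul_le_mul_left ?_ (hv.1 k)
  calc v k * (a k l * w i) = a k l * (v k * w i) := by ring
    _ = (a k l * v i) * w k := by rw [← e3]; ring
    _ ≤ (a i l * v k) * w k := mul_le_mul_of_nonneg_right h (hw.1 k).le
    _ = _ := by ring

theorem eq_of_ratio_eq {v w : Fin 3 → ℝ} (hv : v ∈ interiorRNS) (hw : w ∈ interiorRNS)
    {i : Fin 3} (h : ∀ k, v i * w k = v k * w i) : v = w := by
  have hs : ∑ k, v i * w k = ∑ k, v k * w i := Finset.sum_congr rfl fun k _ => h k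
  rw [← Finset.mul_sum, ← Finset.sum_mul, hv.2, hw.2, mul_one, one_mul] at hs
  ext k
  have := h k
  rw [hs, mul_comm] at this
  exact (mul_right_cancel₀ (hw.1 i).ne' this).symm

/-- Two points of a supporting segment have no vertex strictly between them if and only if every
item has a player that is best for both points. -/
theorem exists_common_best_iff (ha : ∀ i j, 0 < a i j) {v w : Fin 3 → ℝ}
    (hv : v ∈ interiorRNS) (hw : w ∈ interiorRNS) (hvw : v ≠ w) {j : M} {m : Fin 3}
    (hvj : v ∈ supportingSegment a j m) (hwj : w ∈ supportingSegment a j m) :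
    (∀ l, ∃ i, IsBest a (RD v) l i ∧ IsBest a (RD w) l i) ↔
      ∀ u ∈ graphVertices a, u ∉ openSegment ℝ v w := by
  -- Both directions follow the sign of a_ml z_i − a_il z_m, which is linear in z; here i is best
  -- for l among the players other than m, all along the segment.
  constructor
  · intro hcommon u hu huvw
    have huI := hu.1
    have huj : u ∈ supportingSegment a j m :=
      (convex_segment _ _).openSegment_subset hvj hwj huvw
    obtain ⟨-, m₁, m₂, hm, l₁, l₂, h₁, h₂⟩ := (mem_graphVertices ha).1 hu
    obtain ⟨n, hnm, l, hl⟩ : ∃ n, n ≠ m ∧ ∃ l, u ∈ supportingSegment a l n := by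
      by_cases h : m₁ = m
      · exact ⟨m₂, fun h' => hm (h.trans h'.symm), l₂, h₂⟩
      · exact ⟨m₁, h, l₁, h₁⟩
    obtain ⟨i, him, hin⟩ := exists_third m n
    have hui := isBest_of_mem_supportingSegment ha huI hl hin
    have hum := isBest_of_mem_supportingSegment ha huI hl hnm.symm
    rw [isBest_RD huI] at hui hum
    have hiv : ∀ k, k ≠ m → a k l * v i ≤ a i l * v k := fun k hk =>
      le_of_mem_supportingSegment ha huI hv huj hvj him hk (hui k)
    have hiw : ∀ k, k ≠ m → a k l * w i ≤ a i l * w k := fun k hk =>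
      le_of_mem_supportingSegment ha huI hw huj hwj him hk (hui k)
    have g0 : a m l * u i = a i l * u m := le_antisymm (hui m) (hum i)
    obtain ⟨x, hxv, hxw⟩ := hcommon l
    rw [isBest_RD hv] at hxv
    rw [isBest_RD hw] at hxw
    obtain ⟨s, t, hs, ht, hst, rfl⟩ := huvw
    simp only [Pi.add_apply, Pi.smul_apply, smul_eq_mul] at g0
    have g1 : s * (a m l * v i - a i l * v m) + t * (a m l * w i - a i l * w m) = 0 := by
      linarith
    -- The linear function vanishes at the intermediate vertex, and a common best player gives it
    -- the same sign at both ends: nonnegative if that player is m, nonpositive otherwise. So it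
    -- vanishes at both ends, and the ratios fixed by l and j force `v = w`.
    have hzero : a m l * v i - a i l * v m = 0 ∧ a m l * w i - a i l * w m = 0 := by
      have hcases : (0 ≤ a m l * v i - a i l * v m ∧ 0 ≤ a m l * w i - a i l * w m) ∨
          (a m l * v i - a i l * v m ≤ 0 ∧ a m l * w i - a i l * w m ≤ 0) := by
        by_cases hxm : x = m
        · subst hxm
          exact Or.inl ⟨sub_nonneg.2 (hxv i), sub_nonneg.2 (hxw i)⟩
        · right
          have key : ∀ z ∈ interiorRNS, (∀ k, k ≠ m → a k l * z i ≤ a i l * z k) →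
              (∀ k, a k l * z x ≤ a x l * z k) → a m l * z i - a i l * z m ≤ 0 := by
            intro z hz hzi hzx
            have h1 := hzx m
            have h2 := hzi x hxm
            refine sub_nonpos.2 (le_of_mul_le_mul_left ?_ (hz.1 x))
            calc z x * (a m l * z i) = (a m l * z x) * z i := by ring
              _ ≤ (a x l * z m) * z i := mul_le_mul_of_nonneg_right h1 (hz.1 i).le
              _ = (a x l * z i) * z m := by ring
              _ ≤ (a i l * z x) * z m := mul_le_mul_of_nonneg_right h2 (hz.1 m).le
              _ = _ := by ring
          exact ⟨key v hv hiv hxv, key w hw hiw hxw⟩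
      rcases hcases with ⟨h1, h2⟩ | ⟨h1, h2⟩ <;> constructor <;> nlinarith
    refine hvw (eq_of_ratio_eq hv hw (i := i) fun k => ?_)
    obtain ⟨z1, z2⟩ := hzero
    by_cases hk : k = m
    · subst hk
      refine mul_left_cancel₀ (mul_pos (ha i l) (ha k l)).ne' ?_
      calc a i l * a k l * (v i * w k) = (a k l * v i) * (a i l * w k) := by ring
        _ = (a i l * v k) * (a k l * w i) := by
          rw [sub_eq_zero.1 z1, sub_eq_zero.1 z2]
        _ = _ := by ring
    · have e1 := isBest_of_mem_supportingSegment ha hv hvj him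
      have e2 := isBest_of_mem_supportingSegment ha hv hvj hk
      have e3 := isBest_of_mem_supportingSegment ha hw hwj him
      have e4 := isBest_of_mem_supportingSegment ha hw hwj hk
      rw [isBest_RD hv] at e1 e2
      rw [isBest_RD hw] at e3 e4
      have f1 : a k j * v i = a i j * v k := le_antisymm (e1 k) (e2 i)
      have f2 : a k j * w i = a i j * w k := le_antisymm (e3 k) (e4 i)
      refine mul_left_cancel₀ (ha k j).ne' ?_
      calc a k j * (v i * w k) = (a k j * v i) * w k := by ring
        _ = (a i j * w k) * v k := by rw [f1]; ring
        _ = _ := by rw [← f2]; ring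
  · intro hno l
    obtain ⟨i, him, hiv⟩ : ∃ i, i ≠ m ∧ ∀ k, k ≠ m → a k l * v i ≤ a i l * v k := by
      obtain ⟨p, hpm, -⟩ := exists_third m m
      obtain ⟨q, hqp, hqm⟩ := exists_third p m
      have hc := eq_or_eq_or_eq hqp.symm hpm hqm
      rcases le_total (a q l * v p) (a p l * v q) with h | h
      · refine ⟨p, hpm, fun k hk => ?_⟩
        rcases hc k with rfl | rfl | rfl
        · exact le_rfl
        · exact h
        · exact absurd rfl hk
      · refine ⟨q, hqm, fun k hk => ?_⟩
        rcases hc k with rfl | rfl | rfl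
        · exact h
        · exact le_rfl
        · exact absurd rfl hk
    have hbest : ∀ z ∈ interiorRNS, z ∈ supportingSegment a j m →
        (a m l * z i ≤ a i l * z m → IsBest a (RD z) l i) ∧
        (a i l * z m ≤ a m l * z i → IsBest a (RD z) l m) := by
      intro z hz hzj
      have hzi : ∀ k, k ≠ m → a k l * z i ≤ a i l * z k := fun k hk =>
        le_of_mem_supportingSegment ha hv hz hvj hzj him hk (hiv k hk)
      simp only [isBest_RD hz]
      constructor
      · intro h k
        by_cases hk : k = m
        · exact hk ▸ h
        · exact hzi k hk
      · intro h k
        by_cases hk : k = m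
        · rw [hk]
        · refine le_of_mul_le_mul_left ?_ (hz.1 i)
          calc z i * (a k l * z m) = (a k l * z i) * z m := by ring
            _ ≤ (a i l * z k) * z m := mul_le_mul_of_nonneg_right (hzi k hk) (hz.1 m).le
            _ = (a i l * z m) * z k := by ring
            _ ≤ (a m l * z i) * z k := mul_le_mul_of_nonneg_right h (hz.1 k).le
            _ = _ := by ring
    -- Strictly opposite signs at the ends give a zero `u` strictly between. There l ties i with m,
    -- so `u` lies on a segment of l towards the third corner and is a forbidden vertex.
    have hcross : ∀ x y : ℝ, x = a m l * v i - a i l * v m → y = a m l * w i - a i l * w m →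
        ∀ s t : ℝ, 0 < s → 0 < t → s * x + t * y = 0 → False := by
      intro x y hx hy s t hs ht h0
      have hst : 0 < s + t := by positivity
      set u := (s / (s + t)) • v + (t / (s + t)) • w with hu
      have huvw : u ∈ openSegment ℝ v w :=
        ⟨s / (s + t), t / (s + t), by positivity, by positivity, by field_simp, rfl⟩
      have huI := openSegment_subset_interiorRNS hv hw huvw
      have huj : u ∈ supportingSegment a j m :=
        (convex_segment _ _).openSegment_subset hvj hwj huvw
      have g : a m l * u i = a i l * u m := by
        simp only [hu, Pi.add_apply, Pi.smul_apply, smul_eq_mul]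
        subst hx hy
        field_simp
        linarith
      obtain ⟨n, hni, hnm⟩ := exists_third i m
      have hb := hbest u huI huj
      have hul : u ∈ supportingSegment a l n :=
        mem_supportingSegment_of_isBest ha huI him hni.symm hnm.symm (hb.1 g.le) (hb.2 g.ge)
      exact hno u ((mem_graphVertices ha).2 ⟨huI, m, n, hnm.symm, j, l, huj, hul⟩) huvw
    have hbv := hbest v hv hvj
    have hbw := hbest w hw hwj
    rcases le_or_gt (a m l * v i) (a i l * v m) with h1 | h1 <;>
      rcases le_or_gt (a m l * w i) (a i l * w m) with h2 | h2
    · exact ⟨i, hbv.1 h1, hbw.1 h2⟩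
    · rcases h1.eq_or_lt with h1 | h1
      · exact ⟨m, hbv.2 h1.ge, hbw.2 h2.le⟩
      · exact (hcross _ _ rfl rfl (a m l * w i - a i l * w m) (a i l * v m - a m l * v i)
          (by linarith) (by linarith) (by ring)).elim
    · rcases h2.eq_or_lt with h2 | h2
      · exact ⟨m, hbv.2 h1.le, hbw.2 h2.ge⟩
      · exact (hcross _ _ rfl rfl (a i l * w m - a m l * w i) (a m l * v i - a i l * v m)
          (by linarith) (by linarith) (by ring)).elim
    · exact ⟨m, hbv.2 h1.le, hbw.2 h2.le⟩

variable [Fintype M]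

/-- Every allocation that realizes a common point uses only players best at both points. If each
item has just one such player, the allocation and hence the common point is unique; if some item has
two, handing it from one to the other moves within both faces. -/
theorem shareSegment_iff (ha : ∀ i j, 0 < a i j) {v w : Fin 3 → ℝ} (hv : v ∈ interiorRNS)
    (hw : w ∈ interiorRNS) :
    ShareSegment (faceOf a v) (faceOf a w) ↔
      (∃ j m, v ∈ supportingSegment a j m ∧ w ∈ supportingSegment a j m) ∧
        ∀ l, ∃ i, IsBest a (RD v) l i ∧ IsBest a (RD w) l i := by
  classical
  constructor
  · rintro ⟨p, q, hpq, hsub⟩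
    have common : ∀ r ∈ segment ℝ p q, ∃ X, IsAllocation X ∧ value a X = r ∧
        ∀ i j, X i j ≠ 0 → IsBest a (RD v) j i ∧ IsBest a (RD w) j i := by
      intro r hr
      obtain ⟨X, hX, rfl⟩ := (hsub hr).1.1
      exact ⟨X, hX, rfl, fun i j hij => ⟨(value_mem_supportSet hX).1 (hsub hr).1 i j hij,
        (value_mem_supportSet hX).1 (hsub hr).2 i j hij⟩⟩
    obtain ⟨X, hX, rfl, hXb⟩ := common p (left_mem_segment ℝ _ _)
    obtain ⟨Y, hY, rfl, hYb⟩ := common q (right_mem_segment ℝ _ _)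
    have hex : ∀ l, ∃ i, X i l ≠ 0 := fun l => by
      by_contra! h
      have := hX.2 l
      simp [h] at this
    refine ⟨?_, fun l => (hex l).imp fun i hi => hXb i l hi⟩
    by_contra hcon
    have huniq : ∀ j i k, IsBest a (RD v) j i ∧ IsBest a (RD w) j i →
        IsBest a (RD v) j k ∧ IsBest a (RD w) j k → i = k := by
      intro j i k hi hk
      by_contra hik
      obtain ⟨m, hmi, hmk⟩ := exists_third i k
      exact hcon ⟨j, m,
        mem_supportingSegment_of_isBest ha hv hik hmi.symm hmk.symm hi.1 hk.1,
        mem_supportingSegment_of_isBest ha hw hik hmi.symm hmk.symm hi.2 hk.2⟩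
    refine hpq (congrArg _ ?_)
    ext i j
    obtain ⟨x, hx⟩ := hex j
    have hbx := hXb x j hx
    have h0 : ∀ Z : Fin 3 → M → ℝ, IsAllocation Z →
        (∀ i j, Z i j ≠ 0 → IsBest a (RD v) j i ∧ IsBest a (RD w) j i) →
        Z i j = if i = x then 1 else 0 := by
      intro Z hZ hZb
      have hz : ∀ k, k ≠ x → Z k j = 0 := fun k hk => by
        by_contra hne
        exact hk (huniq j k x (hZb k j hne) hbx)
      split_ifs with h
      · subst h
        have := hZ.2 j
        rwa [Finset.sum_eq_single i (fun k _ hk => hz k hk) (by simp)] at this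
      · exact hz i h
    rw [h0 X hX hXb, h0 Y hY hYb]
  · rintro ⟨⟨j, m, hvj, hwj⟩, hcommon⟩
    choose b hbv hbw using hcommon
    obtain ⟨i, him, -⟩ := exists_third m m
    obtain ⟨k, hki, hkm⟩ := exists_third i m
    refine ⟨value a (pureAllocation (Function.update b j i)),
      value a (pureAllocation (Function.update b j k)), fun h => ?_, ?_⟩
    · have := congrFun (value_pureAllocation_update_sub a b j i k) i
      rw [h, sub_self] at this
      simp [hki.symm] at this
      exact (ha i j).ne this
    · have hmem : ∀ x, x ≠ m → value a (pureAllocation (Function.update b j x)) ∈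
          faceOf a v ∩ faceOf a w := fun x hx =>
        ⟨value_pureAllocation_mem_supportSet
          (update_isBest hbv (isBest_of_mem_supportingSegment ha hv hvj hx)),
        value_pureAllocation_mem_supportSet
          (update_isBest hbw (isBest_of_mem_supportingSegment ha hw hwj hx))⟩
      exact ((convex_supportSet _ _).inter (convex_supportSet _ _)).segment_subset
        (hmem i him) (hmem k hkm)

/-- A common point shows that the maximum of `functional δ` over the first face equals its maximum
over the polytope, so `functional δ` exposes the intersection. -/
theorem isExposed_inter_supportSet {γ δ : Fin 3 → ℝ}
    (h : (supportSet a γ ∩ supportSet a δ).Nonempty) :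
    IsExposed ℝ (supportSet a γ) (supportSet a γ ∩ supportSet a δ) := by
  obtain ⟨z, hzγ, hzδ⟩ := h
  refine fun _ => ⟨functional δ, Set.ext fun x => ?_⟩
  simp only [functional_apply]
  constructor
  · rintro ⟨hx, hx'⟩
    exact ⟨hx, fun y hy => hx'.2 y hy.1⟩
  · rintro ⟨hx, hmax⟩
    exact ⟨hx, hx.1, fun y hy => (hzδ.2 y hy).trans (hmax z hzγ)⟩

/-- The directions lie in two distinct planes, so the dimension is below two; the two distinct
points make it positive. -/
theorem finrank_vectorSpan_inter {γ δ p q : Fin 3 → ℝ} (hγ : γ ≠ 0) (hδ : δ ≠ 0)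
    (hne : normalPlane γ ≠ normalPlane δ) (hpq : p ≠ q)
    (hp : p ∈ supportSet a γ ∩ supportSet a δ) (hq : q ∈ supportSet a γ ∩ supportSet a δ) :
    Module.finrank ℝ (vectorSpan ℝ (supportSet a γ ∩ supportSet a δ)) = 1 := by
  set E := vectorSpan ℝ (supportSet a γ ∩ supportSet a δ)
  have h1 : E ≤ normalPlane γ :=
    (vectorSpan_mono ℝ Set.inter_subset_left).trans (vectorSpan_supportSet_le a γ)
  have h2 : E ≤ normalPlane δ :=
    (vectorSpan_mono ℝ Set.inter_subset_right).trans (vectorSpan_supportSet_le a δ)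
  have hpos : 0 < Module.finrank ℝ E := by
    have : Nontrivial E := Submodule.nontrivial_iff_ne_bot.2 fun h => by
      have hm : p -ᵥ q ∈ E := vsub_mem_vectorSpan ℝ hp hq
      rw [h, Submodule.mem_bot, vsub_eq_sub, sub_eq_zero] at hm
      exact hpq hm
    exact Module.finrank_pos
  have hle : Module.finrank ℝ E ≤ 2 := finrank_normalPlane hγ ▸ Submodule.finrank_mono h1
  have hne2 : Module.finrank ℝ E ≠ 2 := fun h => hne <| by
    rw [← Submodule.eq_of_le_of_finrank_eq h1 (h.trans (finrank_normalPlane hγ).symm),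
      ← Submodule.eq_of_le_of_finrank_eq h2 (h.trans (finrank_normalPlane hδ).symm)]
  omega

/-- Once the faces share a segment, their whole intersection is an edge of both, because distinct
points yield distinct planes. -/
theorem shareEdge_iff_shareSegment {v w : Fin 3 → ℝ} (hv : v ∈ interiorRNS)
    (hw : w ∈ interiorRNS) (hvw : v ≠ w) :
    ShareEdge (faceOf a v) (faceOf a w) ↔ ShareSegment (faceOf a v) (faceOf a w) := by
  constructor
  · rintro ⟨E, ⟨hEv, hrank⟩, hEw, -⟩
    have hconv : Convex ℝ E := hEv.convex (convex_supportSet _ _)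
    have hnt : E.Nontrivial := by
      by_contra h
      have := vectorSpan_of_subsingleton ℝ (Set.not_nontrivial_iff.1 h)
      rw [this] at hrank
      simp at hrank
    obtain ⟨p, hp, q, hq, hpq⟩ := hnt
    exact ⟨p, q, hpq, (hconv.segment_subset hp hq).trans
      (Set.subset_inter hEv.subset hEw.subset)⟩
  · rintro ⟨p, q, hpq, hsub⟩
    have hp := hsub (left_mem_segment ℝ p q)
    have hq := hsub (right_mem_segment ℝ p q)
    have hrank := finrank_vectorSpan_inter (ne_zero_of_pos (RD_pos hv))
      (ne_zero_of_pos (RD_pos hw)) (fun h => hvw (RD_injOn hv hw h)) hpq hp hq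
    refine ⟨faceOf a v ∩ faceOf a w, ⟨isExposed_inter_supportSet ⟨p, hp⟩, hrank⟩, ?_, hrank⟩
    rw [Set.inter_comm]
    exact isExposed_inter_supportSet ⟨p, hp.symm⟩

theorem shareSegment_iff_adj (ha : ∀ i j, 0 < a i j) {v w : graphVertices a} (hvw : v ≠ w) :
    ShareSegment (faceOf a v) (faceOf a w) ↔ (graph a).Adj v w := by
  have hne : v.1 ≠ w.1 := fun h => hvw (Subtype.ext h)
  rw [shareSegment_iff ha v.2.1 w.2.1]
  constructor
  · rintro ⟨⟨j, m, hv, hw⟩, h⟩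
    exact ⟨hvw, ⟨j, m, hv, hw⟩, (exists_common_best_iff ha v.2.1 w.2.1 hne hv hw).1 h⟩
  · rintro ⟨-, ⟨j, m, hv, hw⟩, h⟩
    exact ⟨⟨j, m, hv, hw⟩, (exists_common_best_iff ha v.2.1 w.2.1 hne hv hw).2 h⟩

end

end FairDivision

theorem mainTheorem3 {M : Type*} [Fintype M] (a : Fin 3 → M → ℝ)
    (hnorm : ∀ i, ∑ j, a i j = 1) (hMAC : ∀ i j, 0 < a i j) :
    Set.BijOn (FairDivision.faceOf a) (FairDivision.graphVertices a)
        {F | FairDivision.IsParetoFace a F} ∧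
      ∀ v w : FairDivision.graphVertices a, v ≠ w →
        (FairDivision.ShareSegment (FairDivision.faceOf a v) (FairDivision.faceOf a w) ↔
            (FairDivision.graph a).Adj v w) ∧
        (FairDivision.ShareEdge (FairDivision.faceOf a v) (FairDivision.faceOf a w) ↔
            (FairDivision.graph a).Adj v w) := by
  refine ⟨FairDivision.bijOn_faceOf hMAC, fun v w hvw => ?_⟩
  have h := FairDivision.shareSegment_iff_adj hMAC hvw
  refine ⟨h, ?_⟩
  rw [FairDivision.shareEdge_iff_shareSegment v.2.1 w.2.1 fun h => hvw (Subtype.ext h), h]
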